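/- For positive integers $a,b$ with $a+b\ge 3$ let $$\bar T(a,b)=4\sum_{0<n_1<n_2}\frac{(-1)^{n_2}}{(2n_1-1)^{a}(2n_2-2)^{b}}:=\lim_{N\to\infty}4\sum_{n_2=1}^{N}\ \sum_{1\le n_1<n_2}\frac{(-1)^{n_2}}{(2n_1-1)^{a}(2n_2-2)^{b}},$$ and for an integer $w\ge 3$ let $W(w,2)=\sum_{a+b=w,\ a,b\ge 1}\bar T(a,b)$. Let $\bar\zeta(0)=\tfrac12$ and $\bar\zeta(s)=\sum_{n\ge 1}(-1)^{n-1}n^{-s}$ for integers $s\ge 1$. Let $\tilde t(1)=0$ and $\tilde t(n)=2^n\sum_{m\ge 0}(2m+1)^{-n}$ for integers $n>1$. **Theorem 3.4.** Let $k$ be a positive integer. For all positive integers $a,b$ with $a+b=2k+1$ the limit defining $\bar T(a,b)$ exists, and $$W(2k+1,2)=\frac{1}{2^{2k-1}}\sum_{j=1}^{k}\tilde t(2j+1)\,\bar\zeta(2k-2j),$$ where $\tilde t(n)=(2^n-1)\zeta(n)$ for every integer $n>1$. Consequently $W(2k+1,2)$ reduces to zeta values: $$W(2k+1,2)=\frac{1}{2^{2k-1}}\Bigl(\tfrac12(2^{2k+1}-1)\zeta(2k+1)+\sum_{j=1}^{k-1}(2^{2j+1}-1)(1-2^{1-2k+2j})\,\zeta(2j+1)\,\zeta(2k-2j)\Bigr).$$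 -/

import Mathlib

open Filter Topology

/-- Truncation `n₂ ≤ N` of the alternating double `T`-series
`2² ∑_{0 < n₁ < n₂} (-1)^{n₂} / ((2 n₁ - 1)^a (2 n₂ - 2)^b)`. -/
noncomputable def altDoubleTPartial (a b N : ℕ) : ℝ :=
  2 ^ 2 * ∑ n₂ ∈ Finset.Icc 1 N, ∑ n₁ ∈ Finset.Ico 1 n₂,
    (-1 : ℝ) ^ n₂ / ((2 * (n₁ : ℝ) - 1) ^ a * (2 * (n₂ : ℝ) - 2) ^ b)

/-- The alternating double `T`-value with index `(a, b)` and the sign on the largest summation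
variable: the limit of the truncated sums. For `b = 1` the series is only conditionally
convergent, so it is summed in the order of the largest variable. -/
noncomputable def altDoubleT (a b : ℕ) : ℝ :=
  limUnder atTop (altDoubleTPartial a b)

/-- The indices `(a, b)` of positive integers of weight `a + b = w` and depth `2`. -/
def indices2 (w : ℕ) : Finset (ℕ × ℕ) :=
  (Finset.HasAntidiagonal.antidiagonal w).filter fun p => 1 ≤ p.1 ∧ 1 ≤ p.2

/-- The depth two sum `W(w, 2)`. The binomial weights of the general weighted sum
`W_m(w, 2)` are all `1` for `m = 1`. -/
noncomputable def W2 (w : ℕ) : ℝ := ∑ p ∈ indices2 w, altDoubleT p.1 p.2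

/-- The alternating zeta value `∑_{n ≥ 1} (-1)^{n-1} / n^s`, as a limit of partial sums,
with the convention that its value at `0` is `1/2`. -/
noncomputable def altZeta (s : ℕ) : ℝ :=
  if s = 0 then 1 / 2
  else limUnder atTop fun N : ℕ =>
    ∑ n ∈ Finset.Icc 1 N, (-1 : ℝ) ^ (n - 1) / (n : ℝ) ^ s

/-- The depth one `t`-value: the sum of `1 / m^s` over odd positive `m`. -/
noncomputable def tValue (s : ℕ) : ℝ := ∑' n : ℕ, 1 / (2 * (n : ℝ) + 1) ^ s

/-- The normalised `t`-value `2^s t(s)` for `s > 1`, set to `0` otherwise. -/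
noncomputable def tTilde (s : ℕ) : ℝ := if 1 < s then 2 ^ s * tValue s else 0

/-! Both sides are reduced to the same alternating Euler sum. Put `x = 2 n₁ - 1` and `y = 2 n₂ - 2`.
Summing `x^(-a) y^(-b)` over `a + b = 2k + 1` gives `(x^(-2k) - y^(-2k)) / (y - x)`, and `y - x` is
odd. The `x` part is a Cauchy product of `altOdd (2k)` with Leibniz's series for `π/4`, the `y` part
is `altEuler (2k)`; Mertens' theorem then gives `W = 4 (π/4 * altOdd (2k) - altEuler (2k))`
(`sum_altDoubleTPartial`, `W2_eq`). On the other side, a geometric sum in `x^(-2)`, `y^(-2)` turns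
the products `tValue (2j+1) * altEven (2k-2j)`, `j < k`, into `altKernel` times `x^(2-2k) -
y^(2-2k)`. The kernel is absolutely summable, so the `y` part may be summed by rows, giving
`altEuler (2k)`, and the `x` part by columns, giving `π/4 * altOdd (2k) - tValue (2k+1) / 2`
(`sum_tValue_mul_altEven`). The defect is exactly the term `j = k`, since `ζ̄(0) = 1/2`. -/

/-- The double series `∑ (-1)^m / (x (y² - x²))` over odd `x = 2 n + 1` and even `y = 2 m + 2`
is the common source of both Euler sums compared below. -/
noncomputable def altKernel (m n : ℕ) : ℝ :=
  (-1) ^ m / ((2 * (n : ℝ) + 1) * ((2 * (m : ℝ) + 2) ^ 2 - (2 * (n : ℝ) + 1) ^ 2))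

/-- Partial sums of the odd harmonic series. -/
noncomputable def oddHarmonic (m : ℕ) : ℝ := ∑ j ∈ Finset.range m, 1 / (2 * (j : ℝ) + 1)

/-! ### Absolute summability of the kernel -/

lemma even_sub_odd_ne_zero (m n : ℕ) : (2 * (m : ℝ) + 2) - (2 * (n : ℝ) + 1) ≠ 0 := by
  have h : 2 * (m : ℤ) + 2 - (2 * n + 1) ≠ 0 := by omega
  exact_mod_cast h

lemma sq_sub_sq_ne_zero (m n : ℕ) : (2 * (m : ℝ) + 2) ^ 2 - (2 * (n : ℝ) + 1) ^ 2 ≠ 0 := by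
  rw [sq_sub_sq]
  exact mul_ne_zero (by positivity) (even_sub_odd_ne_zero m n)

lemma rpow_three_halves {a : ℝ} (ha : 0 < a) : a ^ (3 / 2 : ℝ) = a * √a := by
  rw [Real.sqrt_eq_rpow, ← Real.rpow_one_add' ha.le (by norm_num)]
  norm_num

/-- With `u = x/2` and `v = (y - x)/2` the kernel is `± 1 / (8 u v (2u + v))`, and AM-GM bounds `√(u
|v|)` by a multiple of `2u + v`. The bound separates in `n` and `m - n`. -/
lemma abs_altKernel_le (m n : ℕ) :
    |altKernel m n| ≤ 1 / |(n : ℝ) + 1 / 2| ^ (3 / 2 : ℝ) *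
      (1 / |(((m : ℤ) - n : ℤ) : ℝ) + 1 / 2| ^ (3 / 2 : ℝ)) := by
  set u : ℝ := n + 1 / 2 with hu
  set v : ℝ := (((m : ℤ) - n : ℤ) : ℝ) + 1 / 2 with hv
  have hu0 : 0 < u := by positivity
  have hv' : v = (m : ℝ) - n + 1 / 2 := by rw [hv]; push_cast; ring
  have hv0 : v ≠ 0 := by
    have := even_sub_odd_ne_zero m n
    intro h
    apply this
    rw [hv'] at h
    linarith
  have hva : 0 < |v| := abs_pos.mpr hv0
  have hm : (0 : ℝ) ≤ m := m.cast_nonneg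
  have hw : 0 < 2 * u + v := by rw [hu, hv']; linarith [n.cast_nonneg (α := ℝ)]
  have hf : |altKernel m n| = 1 / (8 * (u * |v| * (2 * u + v))) := by
    unfold altKernel
    rw [abs_div, abs_pow, abs_neg, abs_one, one_pow]
    congr 1
    rw [show (2 * (n : ℝ) + 1) * ((2 * (m : ℝ) + 2) ^ 2 - (2 * (n : ℝ) + 1) ^ 2)
      = 8 * (u * v * (2 * u + v)) by rw [hu, hv']; ring, abs_mul, abs_mul, abs_mul,
      abs_of_pos hu0, abs_of_pos hw, abs_of_pos (by norm_num : (0 : ℝ) < 8)]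
  rw [hf, abs_of_pos hu0, rpow_three_halves hu0, rpow_three_halves hva, one_div_mul_one_div]
  apply one_div_le_one_div_of_le (by positivity)
  have hs : √u * √|v| ≤ 8 * (2 * u + v) := by
    have h1 := Real.sq_sqrt hu0.le
    have h2 := Real.sq_sqrt hva.le
    have h3 := two_mul_le_add_sq (√u) (√|v|)
    have h4 : u ≤ 2 * u + v := by rw [hu, hv']; linarith
    have h5 : |v| ≤ 2 * u + v := abs_le.mpr ⟨by linarith, by linarith⟩
    linarith
  calc u * √u * (|v| * √|v|) = (u * |v|) * (√u * √|v|) := by ring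
    _ ≤ (u * |v|) * (8 * (2 * u + v)) := by gcongr
    _ = _ := by ring

lemma summable_altKernel : Summable fun p : ℕ × ℕ => altKernel p.1 p.2 := by
  have h1 : Summable fun n : ℕ => 1 / |(n : ℝ) + 1 / 2| ^ (3 / 2 : ℝ) :=
    (Real.summable_one_div_nat_add_rpow _ _).mpr (by norm_num)
  have h2 : Summable fun n : ℤ => 1 / |(n : ℝ) + 1 / 2| ^ (3 / 2 : ℝ) :=
    (Real.summable_one_div_int_add_rpow _ _).mpr (by norm_num)
  have h3 := h1.mul_of_nonneg h2 (fun n => by positivity) (fun n => by positivity)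
  have hinj : Function.Injective fun p : ℕ × ℕ => (p.2, (p.1 : ℤ) - p.2) := by
    rintro ⟨a, b⟩ ⟨c, d⟩ h
    simp only [Prod.mk.injEq] at h ⊢
    omega
  refine Summable.of_norm_bounded (h3.comp_injective hinj) fun p => ?_
  exact abs_altKernel_le p.1 p.2

/-! ### Row and column sums of the kernel -/

lemma tendsto_inv_linear (c : ℝ) :
    Tendsto (fun N : ℕ => 1 / (2 * (N : ℝ) + c)) atTop (𝓝 0) := by
  simp_rw [one_div]
  apply Tendsto.inv_tendsto_atTop
  apply tendsto_atTop_add_const_right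
  exact tendsto_natCast_atTop_atTop.const_mul_atTop (by norm_num)

lemma tendsto_neg_one_pow_div_linear (c : ℝ) :
    Tendsto (fun N : ℕ => (-1 : ℝ) ^ N / (2 * (N : ℝ) + c)) atTop (𝓝 0) := by
  apply squeeze_zero_norm (fun N => ?_) (tendsto_norm_zero.comp (tendsto_inv_linear c))
  simp

/-- Raising `m` by one changes the summand by two telescoping differences, each leaving the boundary
value `1 / (2m + 1)`. -/
lemma tendsto_row_partial (m : ℕ) :
    Tendsto (fun N : ℕ => ∑ n ∈ Finset.range N, (2 / (2 * (n : ℝ) + 1)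
      - 1 / (2 * (n : ℝ) + 1 + 2 * m) - 1 / (2 * (n : ℝ) + 1 - 2 * m))) atTop
      (𝓝 (2 * oddHarmonic m)) := by
  induction m with
  | zero =>
    have : ∀ n : ℕ, (2 / (2 * (n : ℝ) + 1) - 1 / (2 * (n : ℝ) + 1 + 2 * (0 : ℕ))
        - 1 / (2 * (n : ℝ) + 1 - 2 * (0 : ℕ))) = 0 := by
      intro n; simp; ring
    simp_rw [this]
    simp [oddHarmonic]
  | succ m ih =>
    have key : ∀ N : ℕ, ∑ n ∈ Finset.range N, (2 / (2 * (n : ℝ) + 1)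
        - 1 / (2 * (n : ℝ) + 1 + 2 * (m + 1 : ℕ)) - 1 / (2 * (n : ℝ) + 1 - 2 * (m + 1 : ℕ)))
        = ∑ n ∈ Finset.range N, (2 / (2 * (n : ℝ) + 1)
          - 1 / (2 * (n : ℝ) + 1 + 2 * m) - 1 / (2 * (n : ℝ) + 1 - 2 * m))
        + (1 / (2 * (m : ℝ) + 1) - 1 / (2 * (N : ℝ) + (2 * m + 1)))
        + (1 / (2 * (N : ℝ) + (-1 - 2 * m)) + 1 / (2 * (m : ℝ) + 1)) := by
      intro N
      have e1 := Finset.sum_range_sub' (fun i : ℕ => 1 / (2 * (i : ℝ) + (2 * m + 1))) N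
      have e2 := Finset.sum_range_sub (fun i : ℕ => 1 / (2 * (i : ℝ) + (-1 - 2 * m))) N
      have e3 : (1 : ℝ) / (2 * ((0 : ℕ) : ℝ) + (-1 - 2 * m)) = -(1 / (2 * (m : ℝ) + 1)) := by
        rw [← one_div_neg_eq_neg_one_div]; congr 1; push_cast; ring
      have e4 : (1 : ℝ) / (2 * ((0 : ℕ) : ℝ) + (2 * m + 1)) = 1 / (2 * (m : ℝ) + 1) := by
        simp
      rw [e3, sub_neg_eq_add] at e2
      rw [e4] at e1
      rw [← e1, ← e2, ← Finset.sum_add_distrib, ← Finset.sum_add_distrib]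
      apply Finset.sum_congr rfl
      intro n _
      push_cast
      ring_nf
    simp_rw [key]
    have := (ih.add ((tendsto_const_nhds (x := 1 / (2 * (m : ℝ) + 1))).sub
      (tendsto_inv_linear (2 * m + 1)))).add
      ((tendsto_inv_linear (-1 - 2 * m)).add (tendsto_const_nhds (x := 1 / (2 * (m : ℝ) + 1))))
    convert this using 2
    rw [oddHarmonic, Finset.sum_range_succ, ← oddHarmonic]
    ring

lemma row_partial_fraction {x y c : ℝ} (hx : x ≠ 0) (hy : y ≠ 0) (hs : y - x ≠ 0)
    (ha : y + x ≠ 0) :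
    c / (2 * y ^ 2) * (2 / x - 1 / (x + y) - 1 / (x - y)) = c / (x * (y ^ 2 - x ^ 2)) := by
  have hs' : x - y = -(y - x) := by ring
  rw [sq_sub_sq, hs', add_comm x y]
  generalize hd : y - x = d at *
  obtain rfl : y = x + d := by linarith
  field_simp
  ring

lemma column_partial_fraction {x y c : ℝ} (hx : x ≠ 0) (hs : y - x ≠ 0) (ha : y + x ≠ 0) :
    c / (2 * x ^ 2) * (1 / (y - x) - 1 / (y + x)) = c / (x * (y ^ 2 - x ^ 2)) := by
  rw [sq_sub_sq]
  field_simp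
  ring

lemma hasSum_altKernel_row (m : ℕ) :
    HasSum (fun n => altKernel m n)
      ((-1) ^ m * oddHarmonic (m + 1) / (2 * (m : ℝ) + 2) ^ 2) := by
  -- Summability is inherited from the double series, so the limit of the partial sums identifies
  -- the sum.
  have hs : Summable fun n => altKernel m n := summable_altKernel.prod_factor m
  have h := ((tendsto_row_partial (m + 1)).const_mul ((-1) ^ m / (2 * (2 * (m : ℝ) + 2) ^ 2)))
  have h2 := hs.hasSum.tendsto_sum_nat
  have heq : ∀ N : ℕ, (-1) ^ m / (2 * (2 * (m : ℝ) + 2) ^ 2) *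
      ∑ n ∈ Finset.range N, (2 / (2 * (n : ℝ) + 1) - 1 / (2 * (n : ℝ) + 1 + 2 * (m + 1 : ℕ))
      - 1 / (2 * (n : ℝ) + 1 - 2 * (m + 1 : ℕ))) = ∑ n ∈ Finset.range N, altKernel m n := by
    intro N
    rw [Finset.mul_sum]
    refine Finset.sum_congr rfl fun n _ => ?_
    have h1 := even_sub_odd_ne_zero m n
    have h5 : 2 * (n : ℝ) + 1 ≠ 0 := by positivity
    have h6 : 2 * (m : ℝ) + 2 ≠ 0 := by positivity
    unfold altKernel
    push_cast
    rw [← row_partial_fraction h5 h6 h1 (by positivity)]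
    ring_nf
  simp_rw [heq] at h
  have := tendsto_nhds_unique h2 h
  convert hs.hasSum using 1
  rw [this]
  field_simp

/-- For `n = 0` these are two copies of Leibniz's series, one without its first term. Because of the
signs, it is the sum of the expressions for `n` and `n + 1` that telescopes. -/
lemma tendsto_column_partial (n : ℕ) :
    Tendsto (fun M : ℕ => ∑ m ∈ Finset.range M, (-1 : ℝ) ^ m *
      (1 / (2 * (m : ℝ) + 2 - (2 * n + 1)) - 1 / (2 * (m : ℝ) + 2 + (2 * n + 1)))) atTop
      (𝓝 (Real.pi / 2 * (-1) ^ n - 1 / (2 * (n : ℝ) + 1))) := by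
  induction n with
  | zero =>
    have key : ∀ M : ℕ, ∑ m ∈ Finset.range M, (-1 : ℝ) ^ m *
        (1 / (2 * (m : ℝ) + 2 - (2 * (0 : ℕ) + 1)) - 1 / (2 * (m : ℝ) + 2 + (2 * (0 : ℕ) + 1)))
        = ∑ m ∈ Finset.range M, (-1 : ℝ) ^ m / (2 * (m : ℝ) + 1)
          + (∑ m ∈ Finset.range (M + 1), (-1 : ℝ) ^ m / (2 * (m : ℝ) + 1) - 1) := by
      intro M
      rw [Finset.sum_range_succ']
      simp only [pow_zero, CharP.cast_eq_zero, mul_zero, zero_add, div_one, add_sub_cancel_right]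
      rw [← Finset.sum_add_distrib]
      refine Finset.sum_congr rfl fun m _ => ?_
      push_cast
      ring_nf
    simp_rw [key]
    have := Real.tendsto_sum_pi_div_four.add
      (((tendsto_add_atTop_iff_nat 1).mpr Real.tendsto_sum_pi_div_four).sub
        (tendsto_const_nhds (x := (1 : ℝ))))
    convert this using 2
    simp
    ring
  | succ n ih =>
    have key : ∀ M : ℕ, ∑ m ∈ Finset.range M, (-1 : ℝ) ^ m *
        (1 / (2 * (m : ℝ) + 2 - (2 * (n + 1 : ℕ) + 1))
          - 1 / (2 * (m : ℝ) + 2 + (2 * (n + 1 : ℕ) + 1)))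
        = -(∑ m ∈ Finset.range M, (-1 : ℝ) ^ m *
          (1 / (2 * (m : ℝ) + 2 - (2 * n + 1)) - 1 / (2 * (m : ℝ) + 2 + (2 * n + 1))))
        + (-(1 / (2 * (n : ℝ) + 1)) - (-1) ^ M / (2 * (M : ℝ) + (-(2 * n + 1))))
        - (1 / (2 * ((n : ℝ) + 1) + 1) - (-1) ^ M / (2 * (M : ℝ) + (2 * n + 3))) := by
      intro M
      have e1 := Finset.sum_range_sub'
        (fun i : ℕ => (-1 : ℝ) ^ i / (2 * (i : ℝ) + (-(2 * n + 1)))) M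
      have e2 := Finset.sum_range_sub'
        (fun i : ℕ => (-1 : ℝ) ^ i / (2 * (i : ℝ) + (2 * n + 3))) M
      have e3 : (-1 : ℝ) ^ 0 / (2 * ((0 : ℕ) : ℝ) + (-(2 * n + 1)))
          = -(1 / (2 * (n : ℝ) + 1)) := by
        rw [← one_div_neg_eq_neg_one_div, pow_zero]; congr 1; push_cast; ring
      have e4 : (-1 : ℝ) ^ 0 / (2 * ((0 : ℕ) : ℝ) + (2 * n + 3))
          = 1 / (2 * ((n : ℝ) + 1) + 1) := by
        rw [pow_zero]; congr 1; push_cast; ring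
      rw [e3] at e1
      rw [e4] at e2
      rw [← e1, ← e2, ← Finset.sum_neg_distrib, ← Finset.sum_add_distrib,
        ← Finset.sum_sub_distrib]
      refine Finset.sum_congr rfl fun m _ => ?_
      push_cast
      ring_nf
    simp_rw [key]
    have := (ih.neg.add ((tendsto_const_nhds (x := -(1 / (2 * (n : ℝ) + 1)))).sub
      (tendsto_neg_one_pow_div_linear (-(2 * n + 1))))).sub
      ((tendsto_const_nhds (x := 1 / (2 * ((n : ℝ) + 1) + 1))).sub
        (tendsto_neg_one_pow_div_linear (2 * n + 3)))
    convert this using 2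
    push_cast
    ring

lemma hasSum_altKernel_column (n : ℕ) :
    HasSum (fun m => altKernel m n)
      (Real.pi / 4 * ((-1) ^ n / (2 * (n : ℝ) + 1) ^ 2) - 1 / 2 * (1 / (2 * (n : ℝ) + 1) ^ 3)) := by
  have hs : Summable fun m => altKernel m n := summable_altKernel.prod_symm.prod_factor n
  have h := ((tendsto_column_partial n).const_mul (1 / (2 * (2 * (n : ℝ) + 1) ^ 2)))
  have h2 := hs.hasSum.tendsto_sum_nat
  have heq : ∀ M : ℕ, 1 / (2 * (2 * (n : ℝ) + 1) ^ 2) *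
      ∑ m ∈ Finset.range M, (-1 : ℝ) ^ m *
      (1 / (2 * (m : ℝ) + 2 - (2 * n + 1)) - 1 / (2 * (m : ℝ) + 2 + (2 * n + 1)))
      = ∑ m ∈ Finset.range M, altKernel m n := by
    intro M
    rw [Finset.mul_sum]
    refine Finset.sum_congr rfl fun m _ => ?_
    have h1 := even_sub_odd_ne_zero m n
    have h4 : 2 * (m : ℝ) + 2 + (2 * n + 1) ≠ 0 := by positivity
    have h5 : 2 * (n : ℝ) + 1 ≠ 0 := by positivity
    unfold altKernel
    rw [← column_partial_fraction h5 h1 h4]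
    ring
  simp_rw [heq] at h
  have := tendsto_nhds_unique h2 h
  convert hs.hasSum using 1
  rw [this]
  field_simp
  ring

/-! ### Convergence of the double series -/

/-- Partial sums of the series defining the `t`-values. -/
noncomputable def oddPowerSum (a m : ℕ) : ℝ := ∑ j ∈ Finset.range m, 1 / (2 * (j : ℝ) + 1) ^ a

/-- The term `n₂ = 1`, whose denominator vanishes, has an empty inner sum; the others are indexed by
`n₂ = m + 2`, which keeps the sign `(-1)^m`. -/
lemma altDoubleTPartial_succ (a b M : ℕ) :
    altDoubleTPartial a b (M + 1) =
      4 * ∑ m ∈ Finset.range M, (-1 : ℝ) ^ m * (oddPowerSum a (m + 1) / (2 * (m : ℝ) + 2) ^ b) := by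
  unfold altDoubleTPartial
  rw [show (2 : ℝ) ^ 2 = 4 by norm_num]
  congr 1
  rw [← Finset.Ico_succ_right_eq_Icc, Finset.sum_Ico_eq_sum_range]
  simp only [Nat.succ_eq_succ, Nat.succ_eq_add_one, add_tsub_cancel_right]
  rw [Finset.sum_range_succ']
  simp only [add_zero, Finset.Ico_self, Finset.sum_empty]
  refine Finset.sum_congr rfl fun m _ => ?_
  rw [Finset.sum_Ico_eq_sum_range, oddPowerSum, Finset.sum_div, Finset.mul_sum,
    show 1 + (m + 1) - 1 = m + 1 by omega]
  refine Finset.sum_congr rfl fun j _ => ?_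
  rw [div_div, mul_one_div, show 1 + (m + 1) = m + 2 by ring, pow_add]
  push_cast
  ring_nf

lemma antitone_inv_odd_pow (a : ℕ) : Antitone fun j : ℕ => 1 / (2 * (j : ℝ) + 1) ^ a := by
  intro i j hij
  have : (i : ℝ) ≤ j := by exact_mod_cast hij
  dsimp only
  gcongr

lemma antitone_average {u : ℕ → ℝ} (hu : Antitone u) :
    Antitone fun m : ℕ => ((m : ℝ) + 1)⁻¹ * ∑ j ∈ Finset.range (m + 1), u j := by
  refine antitone_nat_of_succ_le fun m => ?_
  rw [Finset.sum_range_succ u (m + 1)]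
  have h : ((m : ℝ) + 1) * u (m + 1) ≤ ∑ j ∈ Finset.range (m + 1), u j := by
    have := Finset.card_nsmul_le_sum (Finset.range (m + 1)) u (u (m + 1))
      fun j hj => hu (Finset.mem_range.mp hj).le
    simpa using this
  push_cast
  rw [inv_mul_eq_div, inv_mul_eq_div, div_le_div_iff₀ (by positivity) (by positivity)]
  linarith

lemma tendsto_inv_odd_pow {a : ℕ} (ha : 1 ≤ a) :
    Tendsto (fun j : ℕ => 1 / (2 * (j : ℝ) + 1) ^ a) atTop (𝓝 0) := by
  have := (tendsto_inv_linear 1).pow a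
  simpa [div_pow, zero_pow (by omega : a ≠ 0)] using this

/-- One factor of `y` turns the inner sum into a running mean of a decreasing null sequence. Such
means decrease to zero, so the alternating series test applies even for `b = 1`. -/
lemma exists_tendsto_altDoubleTPartial {a b : ℕ} (ha : 1 ≤ a) (hb : 1 ≤ b) :
    ∃ l, Tendsto (altDoubleTPartial a b) atTop (𝓝 l) := by
  obtain ⟨b, rfl⟩ := Nat.exists_eq_add_of_le' hb
  have hfac : ∀ m : ℕ, oddPowerSum a (m + 1) / (2 * (m : ℝ) + 2) ^ (b + 1) =
      (((m : ℝ) + 1)⁻¹ * ∑ j ∈ Finset.range (m + 1), 1 / (2 * (j : ℝ) + 1) ^ a) *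
        (1 / 2 * (1 / (2 * (m : ℝ) + 2) ^ b)) := by
    intro m
    rw [oddPowerSum, pow_succ]
    field_simp
  have hnn : ∀ m : ℕ, 0 ≤ ((m : ℝ) + 1)⁻¹ *
      ∑ j ∈ Finset.range (m + 1), 1 / (2 * (j : ℝ) + 1) ^ a := fun m =>
    mul_nonneg (by positivity) (Finset.sum_nonneg fun j _ => by positivity)
  have hanti : Antitone fun m : ℕ => oddPowerSum a (m + 1) / (2 * (m : ℝ) + 2) ^ (b + 1) := by
    intro m n hmn
    have hmn' : (m : ℝ) ≤ n := by exact_mod_cast hmn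
    dsimp only
    rw [hfac, hfac]
    refine mul_le_mul (antitone_average (antitone_inv_odd_pow a) hmn) ?_ (by positivity) (hnn m)
    gcongr
  have hzero : Tendsto (fun m : ℕ => oddPowerSum a (m + 1) / (2 * (m : ℝ) + 2) ^ (b + 1))
      atTop (𝓝 0) := by
    have h1 := (tendsto_add_atTop_iff_nat 1).mpr (tendsto_inv_odd_pow ha).cesaro
    refine squeeze_zero (fun m => ?_) (fun m => ?_) h1
    · rw [hfac]; exact mul_nonneg (hnn m) (by positivity)
    · rw [hfac]
      push_cast
      refine mul_le_of_le_one_right (hnn m) ?_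
      have : 1 / (2 * (m : ℝ) + 2) ^ b ≤ 1 := by
        rw [div_le_one (by positivity)]
        apply one_le_pow₀
        linarith [m.cast_nonneg (α := ℝ)]
      linarith
  obtain ⟨l, hl⟩ := hanti.tendsto_alternating_series_of_tendsto_zero hzero
  refine ⟨4 * l, (tendsto_add_atTop_iff_nat 1).mp ?_⟩
  simp_rw [altDoubleTPartial_succ]
  exact hl.const_mul 4

lemma tendsto_altDoubleTPartial {a b : ℕ} (ha : 1 ≤ a) (hb : 1 ≤ b) :
    Tendsto (altDoubleTPartial a b) atTop (𝓝 (altDoubleT a b)) :=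
  tendsto_nhds_limUnder (exists_tendsto_altDoubleTPartial ha hb)

/-! ### The sum over all indices as a Cauchy product -/

/-- Mertens' theorem on Cauchy products, in terms of partial sums. -/
lemma tendsto_cauchyProduct {p q : ℕ → ℝ} {B : ℝ} (hp : Summable fun j => ‖p j‖)
    (hq : Tendsto (fun n => ∑ i ∈ Finset.range n, q i) atTop (𝓝 B)) :
    Tendsto (fun M => ∑ m ∈ Finset.range M, ∑ j ∈ Finset.range (m + 1), p j * q (m - j)) atTop
      (𝓝 ((∑' j, p j) * B)) := by
  obtain ⟨C, hC⟩ := (Metric.isBounded_range_of_tendsto _ hq).exists_norm_le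
  have hC' : ∀ n, ‖∑ i ∈ Finset.range n, q i‖ ≤ C := fun n => hC _ ⟨n, rfl⟩
  -- Grouped by `j`, the truncation is `∑ p j * Q (M - j)`, where the partial sums `Q` of `q` are
  -- bounded by `C`.
  have h := tendsto_tsum_of_dominated_convergence (𝓕 := atTop)
    (f := fun M j => p j * ∑ i ∈ Finset.range (M - j), q i) (g := fun j => p j * B)
    (bound := fun j => ‖p j‖ * C) (hp.mul_right C)
    (fun j => (hq.comp (tendsto_sub_atTop_nat j)).const_mul _)
    (Eventually.of_forall fun M j => by
      rw [norm_mul]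
      exact mul_le_mul_of_nonneg_left (hC' _) (norm_nonneg _))
  rw [tsum_mul_right] at h
  convert h using 2 with M
  rw [Finset.sum_range_diag_flip M fun j i => p j * q i]
  simp_rw [← Finset.mul_sum]
  -- For `j ≥ M` the truncated subtraction leaves an empty inner sum.
  rw [tsum_eq_sum (s := Finset.range M)]
  intro j hj
  have : M - j = 0 := Nat.sub_eq_zero_of_le (by simpa using hj)
  simp [this]

lemma sum_indices2 (n : ℕ) (f : ℕ → ℕ → ℝ) :
    ∑ p ∈ indices2 (n + 2), f p.1 p.2 = ∑ i ∈ Finset.range (n + 1), f (i + 1) (n - i + 1) := by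
  rw [← Finset.Nat.sum_antidiagonal_eq_sum_range_succ (fun i j => f (i + 1) (j + 1)) n]
  refine Finset.sum_nbij' (fun p => (p.1 - 1, p.2 - 1)) (fun p => (p.1 + 1, p.2 + 1)) ?_ ?_ ?_ ?_ ?_
  all_goals
    rintro ⟨a, b⟩ h
    simp only [indices2, Finset.mem_filter, Finset.HasAntidiagonal.mem_antidiagonal] at h ⊢
  · omega
  · omega
  · obtain ⟨_, h1, h2⟩ := h
    rw [Nat.sub_add_cancel h1, Nat.sub_add_cancel h2]
  · simp
  · obtain ⟨_, h1, h2⟩ := h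
    rw [Nat.sub_add_cancel h1, Nat.sub_add_cancel h2]

lemma sum_indices2_inv {x y : ℝ} (hx : x ≠ 0) (hy : y ≠ 0) (hxy : y - x ≠ 0) (n : ℕ) :
    ∑ p ∈ indices2 (n + 2), 1 / x ^ p.1 / y ^ p.2 =
      (1 / x ^ (n + 1) - 1 / y ^ (n + 1)) / (y - x) := by
  rw [sum_indices2 n fun a b => 1 / x ^ a / y ^ b, eq_div_iff hxy]
  have h := geom_sum₂_mul (1 / x) (1 / y) (n + 1)
  rw [one_div_pow, one_div_pow] at h
  rw [← h, show 1 / x - 1 / y = (y - x) * (1 / x * (1 / y)) by field_simp, Finset.sum_mul,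
    Finset.sum_mul]
  refine Finset.sum_congr rfl fun i _ => ?_
  rw [show n + 1 - 1 - i = n - i by omega, pow_succ, pow_succ, one_div_pow, one_div_pow]
  field_simp

/-- The weighted sum of the truncated series is a Cauchy product minus a single Euler sum. -/
lemma sum_altDoubleTPartial (n M : ℕ) :
    ∑ p ∈ indices2 (n + 2), altDoubleTPartial p.1 p.2 (M + 1) =
      4 * (∑ m ∈ Finset.range M, ∑ j ∈ Finset.range (m + 1),
          (-1 : ℝ) ^ j / (2 * (j : ℝ) + 1) ^ (n + 1) *
            ((-1 : ℝ) ^ (m - j) / (2 * ((m - j : ℕ) : ℝ) + 1))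
        - ∑ m ∈ Finset.range M,
          (-1 : ℝ) ^ m * oddHarmonic (m + 1) / (2 * (m : ℝ) + 2) ^ (n + 1)) := by
  simp_rw [altDoubleTPartial_succ]
  rw [← Finset.mul_sum, Finset.sum_comm, ← Finset.sum_sub_distrib]
  congr 1
  refine Finset.sum_congr rfl fun m _ => ?_
  simp_rw [oddPowerSum, Finset.sum_div, Finset.mul_sum]
  rw [Finset.sum_comm]
  -- As `y - x = 2 (m - j) + 1`, summing `1 / (y - x)` over `j` gives the odd harmonic sum in
  -- reverse order.
  have h1 : oddHarmonic (m + 1) = ∑ j ∈ Finset.range (m + 1), 1 / (2 * ((m - j : ℕ) : ℝ) + 1) := by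
    rw [oddHarmonic, ← Finset.sum_range_reflect]
    refine Finset.sum_congr rfl fun j _ => ?_
    rw [show m + 1 - 1 - j = m - j by omega]
  rw [h1, Finset.mul_sum, Finset.sum_div, ← Finset.sum_sub_distrib]
  refine Finset.sum_congr rfl fun j hj => ?_
  have hj' : j ≤ m := Nat.lt_succ_iff.mp (Finset.mem_range.mp hj)
  rw [← Finset.mul_sum, sum_indices2_inv (by positivity) (by positivity)
    (even_sub_odd_ne_zero m j), Nat.cast_sub hj',
    show 2 * (m : ℝ) + 2 - (2 * j + 1) = 2 * ((m : ℝ) - j) + 1 by ring,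
    div_mul_div_comm, ← pow_add, Nat.add_sub_cancel' hj']
  simp only [div_eq_mul_inv, mul_inv]
  ring

/-! ### Evaluation of the Euler sum and of `W2` -/

lemma hasSum_of_eq {ι : Type*} {f g : ι → ℝ} {a : ℝ} (hg : HasSum g a) (h : ∀ i, f i = g i) :
    HasSum f a := by
  rwa [funext h]

lemma summable_inv_odd_pow {s : ℕ} (hs : 2 ≤ s) :
    Summable fun n : ℕ => 1 / (2 * (n : ℝ) + 1) ^ s := by
  have h := (Real.summable_one_div_nat_pow (p := s)).mpr (by omega)
  have := h.comp_injective (i := fun n : ℕ => 2 * n + 1) fun a b h => by simpa using h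
  simpa [Function.comp_def] using this

lemma summable_inv_even_pow {s : ℕ} (hs : 2 ≤ s) :
    Summable fun n : ℕ => 1 / (2 * (n : ℝ) + 2) ^ s := by
  have h := (Real.summable_one_div_nat_pow (p := s)).mpr (by omega)
  have := h.comp_injective (i := fun n : ℕ => 2 * n + 2) fun a b h => by simpa using h
  simpa [Function.comp_def] using this

/-- The alternating sum over the even positive integers. -/
noncomputable def altEven (s : ℕ) : ℝ := ∑' m : ℕ, (-1 : ℝ) ^ m / (2 * (m : ℝ) + 2) ^ s

/-- The alternating sum over the odd positive integers. -/
noncomputable def altOdd (s : ℕ) : ℝ := ∑' n : ℕ, (-1 : ℝ) ^ n / (2 * (n : ℝ) + 1) ^ s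

/-- The alternating linear Euler sum with odd harmonic numbers. -/
noncomputable def altEuler (s : ℕ) : ℝ :=
  ∑' m : ℕ, (-1 : ℝ) ^ m * oddHarmonic (m + 1) / (2 * (m : ℝ) + 2) ^ s

lemma summable_norm_altEven {s : ℕ} (hs : 2 ≤ s) :
    Summable fun m : ℕ => ‖(-1 : ℝ) ^ m / (2 * (m : ℝ) + 2) ^ s‖ := by
  refine (summable_inv_even_pow hs).congr fun m => ?_
  rw [norm_div, norm_pow, norm_neg, norm_one, one_pow, Real.norm_of_nonneg (by positivity)]

lemma summable_norm_altOdd {s : ℕ} (hs : 2 ≤ s) :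
    Summable fun m : ℕ => ‖(-1 : ℝ) ^ m / (2 * (m : ℝ) + 1) ^ s‖ := by
  refine (summable_inv_odd_pow hs).congr fun m => ?_
  rw [norm_div, norm_pow, norm_neg, norm_one, one_pow, Real.norm_of_nonneg (by positivity)]

lemma summable_altKernel_mul {g : ℕ × ℕ → ℝ} (hg : ∀ p, |g p| ≤ 1) :
    Summable fun p : ℕ × ℕ => altKernel p.1 p.2 * g p := by
  refine Summable.of_norm_bounded summable_altKernel.norm fun p => ?_
  rw [norm_mul]
  exact mul_le_of_le_one_right (norm_nonneg _) (hg p)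

lemma abs_one_div_pow_le_one {x : ℝ} (hx : 1 ≤ x) (s : ℕ) : |1 / x ^ s| ≤ 1 := by
  have : 1 ≤ x ^ s := one_le_pow₀ hx
  rw [abs_of_nonneg (by positivity)]
  exact (div_le_one (by positivity)).mpr this

lemma summable_altKernel_even (s : ℕ) :
    Summable fun p : ℕ × ℕ => altKernel p.1 p.2 * (1 / (2 * (p.1 : ℝ) + 2) ^ s) :=
  summable_altKernel_mul fun p =>
    abs_one_div_pow_le_one (by linarith [p.1.cast_nonneg (α := ℝ)]) s

lemma summable_altKernel_odd (s : ℕ) :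
    Summable fun p : ℕ × ℕ => altKernel p.1 p.2 * (1 / (2 * (p.2 : ℝ) + 1) ^ s) :=
  summable_altKernel_mul fun p =>
    abs_one_div_pow_le_one (by linarith [p.2.cast_nonneg (α := ℝ)]) s

/-- Summation of the weighted kernel by rows. -/
lemma hasSum_altEuler (s : ℕ) :
    HasSum (fun m : ℕ => (-1 : ℝ) ^ m * oddHarmonic (m + 1) / (2 * (m : ℝ) + 2) ^ (s + 2))
      (∑' p : ℕ × ℕ, altKernel p.1 p.2 * (1 / (2 * (p.1 : ℝ) + 2) ^ s)) := by
  have h := (summable_altKernel_even s).hasSum.prod_fiberwise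
    fun m => (hasSum_altKernel_row m).mul_right (1 / (2 * (m : ℝ) + 2) ^ s)
  convert h using 2 with m
  rw [div_mul_div_comm, mul_one, ← pow_add, add_comm 2 s]

/-- Summation of the weighted kernel by columns. -/
lemma tsum_altKernel_odd (s : ℕ) :
    ∑' p : ℕ × ℕ, altKernel p.1 p.2 * (1 / (2 * (p.2 : ℝ) + 1) ^ s) =
      Real.pi / 4 * altOdd (s + 2) - 1 / 2 * tValue (s + 3) := by
  have h := ((Equiv.prodComm ℕ ℕ).hasSum_iff.mpr (summable_altKernel_odd s).hasSum).prod_fiberwise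
    fun n => (hasSum_altKernel_column n).mul_right (1 / (2 * (n : ℝ) + 1) ^ s)
  have h1 := (summable_norm_altOdd (s := s + 2) (by omega)).of_norm.hasSum.mul_left (Real.pi / 4)
  have h2 := (summable_inv_odd_pow (s := s + 3) (by omega)).hasSum.mul_left (1 / 2)
  refine h.unique (hasSum_of_eq (h1.sub h2) fun n => ?_)
  rw [pow_add _ s 2, pow_add _ s 3]
  field_simp

lemma hasSum_mul_of_summable_norm {f g : ℕ → ℝ} {c : ℝ} (hf : Summable fun m => ‖f m‖)
    (hg : Summable fun n => ‖g n‖) (hc : (∑' m, f m) * (∑' n, g n) = c) :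
    HasSum (fun p : ℕ × ℕ => f p.1 * g p.2) c :=
  hc ▸ hf.of_norm.hasSum.mul hg.of_norm.hasSum (summable_mul_of_summable_norm hf hg)

/-- The products of `t`-values and alternating sums combine into an Euler sum. -/
lemma sum_tValue_mul_altEven (K : ℕ) :
    ∑ j ∈ Finset.Ico 1 (K + 1), tValue (2 * j + 1) * altEven (2 * (K + 1) - 2 * j) =
      Real.pi / 4 * altOdd (2 * K + 2) - 1 / 2 * tValue (2 * K + 3) - altEuler (2 * K + 2) := by
  have hprod : ∀ j ∈ Finset.Ico 1 (K + 1),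
      HasSum (fun p : ℕ × ℕ => 1 / (2 * (p.2 : ℝ) + 1) ^ (2 * j + 1) *
        ((-1) ^ p.1 / (2 * (p.1 : ℝ) + 2) ^ (2 * (K + 1) - 2 * j)))
        (tValue (2 * j + 1) * altEven (2 * (K + 1) - 2 * j)) := by
    intro j hj
    rw [Finset.mem_Ico] at hj
    refine hasSum_of_eq (hasSum_mul_of_summable_norm
      (f := fun m : ℕ => (-1 : ℝ) ^ m / (2 * (m : ℝ) + 2) ^ (2 * (K + 1) - 2 * j))
      (g := fun n : ℕ => 1 / (2 * (n : ℝ) + 1) ^ (2 * j + 1))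
      (summable_norm_altEven (by omega)) (summable_inv_odd_pow (by omega)).norm
      ?_) fun p => mul_comm _ _
    exact mul_comm (altEven _) (tValue _)
  have hsum := hasSum_sum hprod
  rw [← tsum_altKernel_odd (2 * K), altEuler, (hasSum_altEuler (2 * K)).tsum_eq]
  refine hsum.unique (hasSum_of_eq
    ((summable_altKernel_odd (2 * K)).hasSum.sub (summable_altKernel_even (2 * K)).hasSum)
    fun p => ?_)
  obtain ⟨m, n⟩ := p
  have hd := sq_sub_sq_ne_zero m n
  dsimp only
  unfold altKernel
  have hx : 2 * (n : ℝ) + 1 ≠ 0 := by positivity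
  have hy : 2 * (m : ℝ) + 2 ≠ 0 := by positivity
  generalize 2 * (n : ℝ) + 1 = x at *
  generalize 2 * (m : ℝ) + 2 = y at *
  -- The factor `y² - x²` released by the geometric sum cancels the one in the kernel.
  have h := geom_sum₂_mul (1 / x ^ 2) (1 / y ^ 2) K
  rw [one_div_pow, one_div_pow, ← pow_mul, ← pow_mul] at h
  rw [← mul_sub, ← h, show 1 / x ^ 2 - 1 / y ^ 2 = (y ^ 2 - x ^ 2) * (1 / x ^ 2 * (1 / y ^ 2)) by
    field_simp, Finset.sum_Ico_eq_sum_range, Nat.add_sub_cancel, Finset.sum_mul, Finset.mul_sum]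
  refine Finset.sum_congr rfl fun i hi => ?_
  rw [Finset.mem_range] at hi
  obtain ⟨l, rfl⟩ : ∃ l, K = i + l + 1 := ⟨K - i - 1, by omega⟩
  rw [show 2 * (i + l + 1 + 1) - 2 * (1 + i) = 2 * l + 2 by omega,
    show i + l + 1 - 1 - i = l by omega, one_div_pow, one_div_pow, ← pow_mul, ← pow_mul]
  field_simp
  ring

lemma W2_eq (K : ℕ) :
    W2 (2 * K + 3) = 4 * (Real.pi / 4 * altOdd (2 * K + 2) - altEuler (2 * K + 2)) := by
  have h1 : Tendsto (fun M => ∑ p ∈ indices2 (2 * K + 3), altDoubleTPartial p.1 p.2 (M + 1)) atTop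
      (𝓝 (W2 (2 * K + 3))) := by
    refine tendsto_finsetSum _ fun p hp => (tendsto_add_atTop_iff_nat 1).mpr ?_
    simp only [indices2, Finset.mem_filter] at hp
    exact tendsto_altDoubleTPartial hp.2.1 hp.2.2
  refine tendsto_nhds_unique h1 ?_
  simp_rw [show 2 * K + 3 = (2 * K + 1) + 2 by ring, sum_altDoubleTPartial]
  have h2 := tendsto_cauchyProduct (summable_norm_altOdd (s := 2 * K + 2) (by omega))
    Real.tendsto_sum_pi_div_four
  have h3 := (hasSum_altEuler (2 * K)).summable.hasSum.tendsto_sum_nat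
  rw [mul_comm (Real.pi / 4)]
  exact (h2.sub h3).const_mul 4

lemma hasSum_altZeta {s : ℕ} (hs : 2 ≤ s) :
    HasSum (fun m : ℕ => (-1 : ℝ) ^ m / ((m : ℝ) + 1) ^ s) (altZeta s) := by
  have hsum : Summable fun m : ℕ => (-1 : ℝ) ^ m / ((m : ℝ) + 1) ^ s := by
    refine Summable.of_norm ?_
    have h := (summable_nat_add_iff 1).mpr
      ((Real.summable_one_div_nat_pow (p := s)).mpr (by omega))
    refine h.congr fun m => ?_
    rw [norm_div, norm_pow, norm_neg, norm_one, one_pow, Real.norm_of_nonneg (by positivity)]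
    push_cast
    rfl
  have ht := hsum.hasSum.tendsto_sum_nat
  have heq : altZeta s = ∑' m : ℕ, (-1 : ℝ) ^ m / ((m : ℝ) + 1) ^ s := by
    rw [altZeta, if_neg (by omega)]
    refine Tendsto.limUnder_eq ?_
    convert ht using 2 with N
    rw [← Finset.Ico_succ_right_eq_Icc, Finset.sum_Ico_eq_sum_range]
    simp [add_comm]
  rw [heq]
  exact hsum.hasSum

lemma altZeta_eq_two_pow_mul_altEven {s : ℕ} (hs : 2 ≤ s) : altZeta s = 2 ^ s * altEven s := by
  rw [altEven, ← tsum_mul_left, ← (hasSum_altZeta hs).tsum_eq]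
  refine tsum_congr fun m => ?_
  rw [show 2 * (m : ℝ) + 2 = 2 * (m + 1) by ring, mul_pow]
  field_simp

lemma W2_eq_sum_tTilde_mul_altZeta {k : ℕ} (hk : 1 ≤ k) :
    W2 (2 * k + 1) =
      1 / 2 ^ (2 * k - 1) *
        ∑ j ∈ Finset.Icc 1 k, tTilde (2 * j + 1) * altZeta (2 * k - 2 * j) := by
  obtain ⟨K, rfl⟩ := Nat.exists_eq_add_of_le' hk
  have hterm : ∀ j ∈ Finset.Ico 1 (K + 1),
      tTilde (2 * j + 1) * altZeta (2 * (K + 1) - 2 * j) =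
        2 ^ (2 * K + 3) * (tValue (2 * j + 1) * altEven (2 * (K + 1) - 2 * j)) := by
    intro j hj
    rw [Finset.mem_Ico] at hj
    rw [tTilde, if_pos (by omega), altZeta_eq_two_pow_mul_altEven (by omega),
      show 2 * K + 3 = (2 * j + 1) + (2 * (K + 1) - 2 * j) by omega, pow_add]
    ring
  -- The top term, with `altZeta 0 = 1/2`, cancels the `-tValue / 2` left by the column sums.
  rw [← Finset.Ico_succ_right_eq_Icc, Nat.succ_eq_succ, Nat.succ_eq_add_one,
    Finset.sum_Ico_succ_top (by omega), Finset.sum_congr rfl hterm, ← Finset.mul_sum,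
    sum_tValue_mul_altEven, Nat.sub_self, altZeta, if_pos rfl, tTilde, if_pos (by omega),
    show 2 * (K + 1) + 1 = 2 * K + 3 by ring, W2_eq,
    show 2 * (K + 1) - 1 = 2 * K + 1 by omega, show 2 * K + 3 = (2 * K + 1) + 2 by ring, pow_add]
  field_simp
  ring

/-! ### Reduction to zeta values -/

/-- The real Dirichlet series of the zeta function at a natural number. -/
lemma hasSum_zeta {n : ℕ} (hn : 1 < n) :
    ∃ z : ℝ, (z : ℂ) = riemannZeta n ∧ HasSum (fun m : ℕ => 1 / (m : ℝ) ^ n) z := by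
  refine ⟨_, ?_, (Real.summable_one_div_nat_pow.mpr hn).hasSum⟩
  rw [zeta_nat_eq_tsum_of_gt_one hn, Complex.ofReal_tsum]
  push_cast
  rfl

lemma hasSum_even_of_hasSum_zeta {n : ℕ} {z : ℝ} (hz : HasSum (fun m : ℕ => 1 / (m : ℝ) ^ n) z) :
    HasSum (fun m : ℕ => 1 / ((2 * m : ℕ) : ℝ) ^ n) (z / 2 ^ n) := by
  refine hasSum_of_eq (hz.div_const (2 ^ n)) fun m => ?_
  push_cast
  rw [mul_pow, div_div, mul_comm]

lemma tValue_eq {n : ℕ} (hn : 1 < n) {z : ℝ} (hz : HasSum (fun m : ℕ => 1 / (m : ℝ) ^ n) z) :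
    tValue n = z - z / 2 ^ n := by
  have h2 := (summable_inv_odd_pow (s := n) hn).hasSum
  have h2' : HasSum (fun m : ℕ => 1 / ((2 * m + 1 : ℕ) : ℝ) ^ n) (tValue n) := by
    push_cast
    exact h2
  have := ((hasSum_even_of_hasSum_zeta hz).even_add_odd (f := fun m : ℕ => 1 / (m : ℝ) ^ n)
    h2').unique hz
  linarith

lemma tTilde_eq {n : ℕ} (hn : 1 < n) {z : ℝ} (hz : HasSum (fun m : ℕ => 1 / (m : ℝ) ^ n) z) :
    tTilde n = (2 ^ n - 1) * z := by
  rw [tTilde, if_pos hn, tValue_eq hn hz]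
  field_simp

lemma altZeta_eq {n : ℕ} (hn : 1 < n) {z : ℝ} (hz : HasSum (fun m : ℕ => 1 / (m : ℝ) ^ n) z) :
    altZeta n = (1 - 2 / 2 ^ n) * z := by
  have hodd : HasSum (fun m : ℕ => (-1 : ℝ) ^ (2 * m) / (((2 * m : ℕ) : ℝ) + 1) ^ n)
      (tValue n) := by
    refine hasSum_of_eq (summable_inv_odd_pow (s := n) hn).hasSum fun m => ?_
    push_cast
    rw [pow_mul]
    simp
  have heven : HasSum (fun m : ℕ => (-1 : ℝ) ^ (2 * m + 1) / (((2 * m + 1 : ℕ) : ℝ) + 1) ^ n)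
      (-(z / 2 ^ n)) := by
    have h := hasSum_even_of_hasSum_zeta hz
    -- The term `m = 0` is dropped; it equals `1 / 0 ^ n = 0` by convention.
    have h' := ((hasSum_nat_add_iff' 1).mpr h).neg
    have h0 : ∑ i ∈ Finset.range 1, 1 / ((2 * i : ℕ) : ℝ) ^ n = 0 := by
      simp [zero_pow (by omega : n ≠ 0)]
    rw [h0, sub_zero] at h'
    refine hasSum_of_eq h' fun m => ?_
    push_cast
    rw [pow_succ, pow_mul]
    norm_num
    ring_nf
  have := (hodd.even_add_odd (f := fun m : ℕ => (-1 : ℝ) ^ m / ((m : ℝ) + 1) ^ n) heven).unique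
    (hasSum_altZeta hn)
  rw [← this, tValue_eq hn hz]
  ring

lemma ofReal_tTilde {n : ℕ} (hn : 1 < n) :
    ((tTilde n : ℝ) : ℂ) = (2 ^ n - 1) * riemannZeta (n : ℂ) := by
  obtain ⟨z, hz, hs⟩ := hasSum_zeta hn
  rw [← hz, tTilde_eq hn hs]
  push_cast
  rfl

lemma ofReal_altZeta {n : ℕ} (hn : 1 < n) :
    ((altZeta n : ℝ) : ℂ) = (1 - 2 / 2 ^ n) * riemannZeta (n : ℂ) := by
  obtain ⟨z, hz, hs⟩ := hasSum_zeta hn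
  rw [← hz, altZeta_eq hn hs]
  push_cast
  rfl

theorem theorem3p4 (k : ℕ) (hk : 1 ≤ k) :
    -- every series in the weighted sum converges
    (∀ a b : ℕ, 1 ≤ a → 1 ≤ b → a + b = 2 * k + 1 →
      Tendsto (altDoubleTPartial a b) atTop (𝓝 (altDoubleT a b))) ∧
    -- the evaluation
    W2 (2 * k + 1) =
      1 / 2 ^ (2 * k - 1) *
        ∑ j ∈ Finset.Icc 1 k, tTilde (2 * j + 1) * altZeta (2 * k - 2 * j) ∧
    -- the normalised t-values in terms of zeta values
    (∀ n : ℕ, 1 < n → ((tTilde n : ℝ) : ℂ) = (2 ^ n - 1) * riemannZeta (n : ℂ)) ∧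
    -- the resulting expression in zeta values
    ((W2 (2 * k + 1) : ℝ) : ℂ) =
      1 / 2 ^ (2 * k - 1) *
        ((2 ^ (2 * k + 1) - 1) * riemannZeta ((2 * k + 1 : ℕ) : ℂ) / 2 +
          ∑ j ∈ Finset.Ico 1 k,
            (2 ^ (2 * j + 1) - 1) * riemannZeta ((2 * j + 1 : ℕ) : ℂ) *
              ((1 - 2 / 2 ^ (2 * k - 2 * j)) *
                riemannZeta ((2 * k - 2 * j : ℕ) : ℂ))) := by
  refine ⟨fun a b ha hb _ => tendsto_altDoubleTPartial ha hb, W2_eq_sum_tTilde_mul_altZeta hk,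
    fun n hn => ofReal_tTilde hn, ?_⟩
  rw [W2_eq_sum_tTilde_mul_altZeta hk, ← Finset.Ico_succ_right_eq_Icc, Nat.succ_eq_succ,
    Nat.succ_eq_add_one, Finset.sum_Ico_succ_top hk, Nat.sub_self, altZeta, if_pos rfl,
    Complex.ofReal_mul, Complex.ofReal_add, Complex.ofReal_mul, ofReal_tTilde (by omega),
    Complex.ofReal_sum]
  have hsum : ∀ j ∈ Finset.Ico 1 k,
      ((tTilde (2 * j + 1) * altZeta (2 * k - 2 * j) : ℝ) : ℂ) =
        (2 ^ (2 * j + 1) - 1) * riemannZeta ((2 * j + 1 : ℕ) : ℂ) *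
          ((1 - 2 / 2 ^ (2 * k - 2 * j)) * riemannZeta ((2 * k - 2 * j : ℕ) : ℂ)) := by
    intro j hj
    rw [Finset.mem_Ico] at hj
    rw [Complex.ofReal_mul, ofReal_tTilde (by omega), ofReal_altZeta (by omega)]
  rw [Finset.sum_congr rfl hsum]
  push_cast
  ring
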